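/- **Hypergraphs.** For a set $C$ of labels with a function $type\colon C\to\mathbb N$, a (hyper)graph over $C$ is a tuple $G=\langle V,E,att,lab,ext\rangle$ with finite sets $V$ of nodes and $E$ of edges, a map $att$ sending each edge to a string of pairwise distinct nodes, a labelling $lab\colon E\to C$ with $type(lab(e))=|att(e)|=:type(e)$, and a string $ext$ of pairwise distinct external nodes; $type(G):=|ext|$. Isomorphic graphs are identified. The handle $a^\bullet$ is the graph with $type(a)$ nodes, all external, and one $a$-labelled edge with $att=ext$. If $e_1,\dots,e_k$ are distinct edges of $G$ and $type(H_i)=type(e_i)$, then $G[e_1/H_1,\dots,e_k/H_k]$ is obtained by removing the $e_i$, inserting disjoint copies of the $H_i$, and fusing the $j$-th external node of $H_i$ with the $j$-th attachment node of $e_i$; its external nodes are those of $G$. $G[e:=a]$ is $G$ with $e$ relabelled by $a$. **Types and sequents.** Let $Pr$ be a set of primitive types with a function $type\colon Pr\to\mathbb N$. The types are generated as follows: each $p\in Pr$ is a type; if $N$ is a type and $D$ is a graph with exactly one edge $d_0$ labelled by the special symbol $\$$ (allowed on edges of any type), all other edges being labelled by types, and $type(N)=type(D)$, then $N\div D$ is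 a type with $type(N\div D):=type_D(d_0)$; if $M$ is a graph labelled by types, then $\times(M)$ is a type with $type(\times(M)):=type(M)$. A sequent $H\to A$ consists of a graph $H$ labelled by types and a type $A$ with $type(H)=type(A)$. **The calculus $\mathrm{HL}$.** The axioms are $p^\bullet\to p$ for $p\in Pr$. The rules are: * $(\div\to)$: from $H\to A$ and $H_1\to lab(d_1),\dots,H_k\to lab(d_k)$ infer $H[e/D][d_0:=N\div D][d_1/H_1,\dots,d_k/H_k]\to A$, where $e\in E_H$, $lab(e)=N$, $E_D=\{d_0,d_1,\dots,d_k\}$ and $lab(d_0)=\$$; * $(\to\div)$: from $D[d_0/F]\to N$ infer $F\to N\div D$, where $d_0$ is the $\$$-edge of $D$; * $(\times\to)$: from $G[e/F]\to A$ infer $G\to A$, where $e\in E_G$ and $lab(e)=\times(F)$; * $(\to\times)$: from $H_1\to lab(m_1),\dots,H_l\to lab(m_l)$ infer $M[m_1/H_1,\dots,m_l/H_l]\to\times(M)$, where $E_M=\{m_1,\dots,m_l\}$. The cut rule is: from sequents $H\to A$ and $G\to B$ infer $G[e_0/H]\to B$, where $e_0\in E_G$ and $lab(e_0)=A$. **Theorem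 (cut elimination).** If a sequent $F\to B$ is derivable in $\mathrm{HL}$ enriched with the cut rule, then it is derivable in $\mathrm{HL}$. In particular the cut rule is admissible in $\mathrm{HL}$: if $H\to A$ and $G\to B$ are derivable in $\mathrm{HL}$ and $e_0\in E_G$ is labelled by $A$, then $G[e_0/H]\to B$ is derivable in $\mathrm{HL}$. -/

import Mathlib

/-! Hypergraphs over a ranked label set, hyperedge replacement, and the types, sequents and
rules of the hypergraph Lambek calculus `HL`. Graphs are finite, and isomorphic graphs are
identified (also inside types). -/

universe u

/-- A (finite) hypergraph whose edges carry labels from `C`; `ty c` is the type of the label `c`.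
Attachment strings and the string of external nodes have no repetitions, and an edge
with label `c` has exactly `ty c` attachment nodes. -/
structure HGraph {C : Type u} (ty : C → ℕ) where
  V : Type
  E : Type
  finite_V : Finite V
  finite_E : Finite E
  att : E → List V
  att_nodup : ∀ e, (att e).Nodup
  lab : E → C
  att_length : ∀ e, (att e).length = ty (lab e)
  ext : List V
  ext_nodup : ext.Nodup

namespace HGraph

variable {C : Type u} {ty : C → ℕ}

/-- `type_G(e)`: the number of attachment nodes of the edge `e`. -/
def edgeType (G : HGraph ty) (e : G.E) : ℕ := (G.att e).length

/-- `type(G)`: the number of external nodes of `G`. -/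
def gtype (G : HGraph ty) : ℕ := G.ext.length

/-- `G` and `H` are isomorphic. -/
def IsIso (G H : HGraph ty) : Prop :=
  ∃ (v : G.V ≃ H.V) (ε : G.E ≃ H.E),
    (∀ e, H.att (ε e) = (G.att e).map v) ∧ (∀ e, H.lab (ε e) = G.lab e) ∧ H.ext = G.ext.map v

/-- The handle `a^•`: a single edge labelled `a`, attached to all nodes, all nodes external. -/
def handle (ty : C → ℕ) (a : C) : HGraph ty where
  V := Fin (ty a)
  E := Unit
  finite_V := inferInstance
  finite_E := inferInstance
  att _ := List.finRange (ty a)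
  att_nodup _ := List.nodup_finRange _
  lab _ := a
  att_length _ := List.length_finRange
  ext := List.finRange (ty a)
  ext_nodup := List.nodup_finRange _

section Replacement

variable (G : HGraph ty) {ι : Type} (ε : ι ↪ G.E) (H : ι → HGraph ty)
  (h : ∀ i, (H i).gtype = G.edgeType (ε i))

open Classical in
/-- Where a node of `H i` is sent in `G[ε i / H i, i ∈ ι]`: the `k`-th external node of `H i` is
fused with the `k`-th attachment node of the edge `ε i`; every other node is a new node. -/
noncomputable def fuse (i : ι) (v : (H i).V) :
    G.V ⊕ (Σ i, {v : (H i).V // v ∉ (H i).ext}) :=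
  if hv : v ∈ (H i).ext then
    Sum.inl ((G.att (ε i))[(H i).ext.idxOf v]'(by
      have h1 := List.idxOf_lt_length_of_mem hv
      have h2 := h i
      unfold gtype edgeType at h2
      omega))
  else Sum.inr ⟨i, ⟨v, hv⟩⟩

theorem fuse_injective (i : ι) : Function.Injective (G.fuse ε H h i) := by
  classical
  intro v w hvw
  unfold fuse at hvw
  by_cases hv : v ∈ (H i).ext <;> by_cases hw : w ∈ (H i).ext
  · rw [dif_pos hv, dif_pos hw] at hvw
    have h1 := (List.Nodup.getElem_inj_iff (G.att_nodup (ε i))).1 (Sum.inl.inj hvw)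
    exact (List.idxOf_inj hv).1 h1
  · rw [dif_pos hv, dif_neg hw] at hvw
    exact absurd hvw (by simp)
  · rw [dif_neg hv, dif_pos hw] at hvw
    exact absurd hvw (by simp)
  · rw [dif_neg hv, dif_neg hw] at hvw
    simpa using hvw

/-- Simultaneous hyperedge replacement `G[e₁/H₁, …, e_k/H_k]` of the distinct edges `e_i = ε i`
by disjoint copies of the graphs `H i`. -/
noncomputable def replaceAll : HGraph ty where
  V := G.V ⊕ (Σ i, {v : (H i).V // v ∉ (H i).ext})
  E := {e : G.E // e ∉ Set.range ε} ⊕ (Σ i, (H i).E)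
  finite_V := by
    have := G.finite_V
    have := G.finite_E
    have := fun i => (H i).finite_V
    have : Finite ι := Finite.of_injective ε ε.injective
    infer_instance
  finite_E := by
    have := G.finite_E
    have := fun i => (H i).finite_E
    have : Finite ι := Finite.of_injective ε ε.injective
    infer_instance
  att := Sum.elim (fun e => (G.att e.1).map Sum.inl)
    (fun f => ((H f.1).att f.2).map (G.fuse ε H h f.1))
  att_nodup := by
    rintro (e | f)
    · exact (G.att_nodup e.1).map Sum.inl_injective
    · exact ((H f.1).att_nodup f.2).map (G.fuse_injective ε H h f.1)
  lab := Sum.elim (fun e => G.lab e.1) (fun f => (H f.1).lab f.2)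
  att_length := by
    rintro (e | f)
    · simpa using G.att_length e.1
    · simpa using (H f.1).att_length f.2
  ext := G.ext.map Sum.inl
  ext_nodup := G.ext_nodup.map Sum.inl_injective

end Replacement

/-- Replacement `G[e₀/H]` of a single edge. -/
noncomputable def replaceEdge (G : HGraph ty) (e₀ : G.E) (H : HGraph ty)
    (h : H.gtype = G.edgeType e₀) : HGraph ty :=
  G.replaceAll (ι := Unit) ⟨fun _ => e₀, fun _ _ _ => rfl⟩ (fun _ => H) (fun _ => h)

end HGraph

/-- A graph with exactly one edge labelled by the symbol `$`, the other edges being labelled by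
elements of `C`. The underlying `HGraph` holds the nodes, the external nodes and the edges other
than the `$`-edge; `dollar` is the attachment string of the `$`-edge. -/
structure Denominator {C : Type u} (ty : C → ℕ) extends HGraph ty where
  dollar : List V
  dollar_nodup : dollar.Nodup

/-- `D[d₀ := a]`, where `d₀` is the `$`-edge of `D`. In the resulting graph `none` is the edge `d₀`,
and `some d` is the edge `d` of `D`. -/
def Denominator.relabel {C : Type u} {ty : C → ℕ} (D : Denominator ty) (a : C)
    (h : ty a = D.dollar.length) : HGraph ty where
  V := D.V
  E := Option D.E
  finite_V := D.finite_V
  finite_E := by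
    have := D.finite_E
    infer_instance
  att o := o.elim D.dollar D.att
  att_nodup := by
    rintro (_ | e)
    · exact D.dollar_nodup
    · exact D.att_nodup e
  lab o := o.elim a D.lab
  att_length := by
    rintro (_ | e)
    · exact h.symm
    · exact D.att_length e
  ext := D.ext
  ext_nodup := D.ext_nodup

/-- Raw syntax of types. In `div N V E att lab dollar ext` the graph data describe the
denominator: `E` are the edges other than the `$`-edge, and `dollar` is the attachment string of
the `$`-edge. -/
inductive PreTp (Pr : Type) : Type 1 where
  | prim (p : Pr) : PreTp Pr
  | div (N : PreTp Pr) (V E : Type) (att : E → List V) (lab : E → PreTp Pr)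
      (dollar ext : List V) : PreTp Pr
  | times (V E : Type) (att : E → List V) (lab : E → PreTp Pr) (ext : List V) : PreTp Pr

namespace PreTp

variable {Pr : Type} (ty : Pr → ℕ)

/-- The number `type(T)`. -/
def rank : PreTp Pr → ℕ
  | prim p => ty p
  | div _ _ _ _ _ dollar _ => dollar.length
  | times _ _ _ _ ext => ext.length

/-- All the graphs occurring in the raw type, at any depth, are (finite) hypergraphs, and
`type(N) = type(D)` for every occurring `N ÷ D`. -/
def WF : PreTp Pr → Prop
  | prim _ => True
  | div N V E att lab dollar ext =>
      N.WF ∧ (∀ e, (lab e).WF) ∧ Finite V ∧ Finite E ∧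
      (∀ e, (att e).Nodup) ∧ (∀ e, (att e).length = (lab e).rank ty) ∧
      dollar.Nodup ∧ ext.Nodup ∧ N.rank ty = ext.length
  | times V E att lab ext =>
      (∀ e, (lab e).WF) ∧ Finite V ∧ Finite E ∧
      (∀ e, (att e).Nodup) ∧ (∀ e, (att e).length = (lab e).rank ty) ∧ ext.Nodup

/-- Equality of types when isomorphic graphs are not distinguished. -/
inductive Equiv : PreTp Pr → PreTp Pr → Prop where
  | prim (p : Pr) : Equiv (prim p) (prim p)
  | div {N N' : PreTp Pr} {V V' E E' : Type} {att : E → List V} {att' : E' → List V'}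
      {lab : E → PreTp Pr} {lab' : E' → PreTp Pr} {dollar ext : List V} {dollar' ext' : List V'}
      (hN : Equiv N N') (v : V ≃ V') (ε : E ≃ E')
      (hatt : ∀ e, att' (ε e) = (att e).map v) (hlab : ∀ e, Equiv (lab e) (lab' (ε e)))
      (hdollar : dollar' = dollar.map v) (hext : ext' = ext.map v) :
      Equiv (div N V E att lab dollar ext) (div N' V' E' att' lab' dollar' ext')
  | times {V V' E E' : Type} {att : E → List V} {att' : E' → List V'}
      {lab : E → PreTp Pr} {lab' : E' → PreTp Pr} {ext : List V} {ext' : List V'}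
      (v : V ≃ V') (ε : E ≃ E')
      (hatt : ∀ e, att' (ε e) = (att e).map v) (hlab : ∀ e, Equiv (lab e) (lab' (ε e)))
      (hext : ext' = ext.map v) :
      Equiv (times V E att lab ext) (times V' E' att' lab' ext')

theorem Equiv.rfl' (T : PreTp Pr) : Equiv T T := by
  induction T with
  | prim p => exact .prim p
  | div N V E att lab d x hN hl =>
    exact .div hN (.refl _) (.refl _) (by simp) hl (by simp) (by simp)
  | times V E att lab x hl =>
    exact .times (.refl _) (.refl _) (by simp) hl (by simp)

theorem Equiv.symm' {S T : PreTp Pr} (h : Equiv S T) : Equiv T S := by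
  induction h with
  | prim p => exact .prim p
  | div hN v ε hatt hlab hd hx ihN ih =>
    refine .div ihN v.symm ε.symm (fun e => ?_) (fun e => ?_) (by simp [hd]) (by simp [hx])
    · have := hatt (ε.symm e)
      simp only [Equiv.apply_symm_apply] at this
      simp [this]
    · simpa using ih (ε.symm e)
  | times v ε hatt hlab hx ih =>
    refine .times v.symm ε.symm (fun e => ?_) (fun e => ?_) (by simp [hx])
    · have := hatt (ε.symm e)
      simp only [Equiv.apply_symm_apply] at this
      simp [this]
    · simpa using ih (ε.symm e)

theorem Equiv.trans' {R S T : PreTp Pr} (h : Equiv R S) (h' : Equiv S T) : Equiv R T := by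
  induction h generalizing T with
  | prim p => exact h'
  | div hN v ε hatt hlab hd hx ihN ih =>
    cases h' with
    | div hN' v' ε' hatt' hlab' hd' hx' =>
      exact .div (ihN hN') (v.trans v') (ε.trans ε') (by simp [hatt, hatt'])
        (fun e => ih e (hlab' (ε e))) (by simp [hd, hd']) (by simp [hx, hx'])
  | times v ε hatt hlab hx ih =>
    cases h' with
    | times v' ε' hatt' hlab' hx' =>
      exact .times (v.trans v') (ε.trans ε') (by simp [hatt, hatt'])
        (fun e => ih e (hlab' (ε e))) (by simp [hx, hx'])

theorem Equiv.rank_eq {S T : PreTp Pr} (h : Equiv S T) : S.rank ty = T.rank ty := by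
  cases h with
  | prim p => rfl
  | div hN v ε hatt hlab hd hx => simp [rank, hd]
  | times v ε hatt hlab hx => simp [rank, hx]

instance setoid : Setoid {T : PreTp Pr // T.WF ty} where
  r S T := Equiv S.1 T.1
  iseqv := ⟨fun T => Equiv.rfl' T.1, Equiv.symm', Equiv.trans'⟩

end PreTp

/-- The set `Tp(HL)` of types over the primitive types `Pr`. -/
def Tp {Pr : Type} (ty : Pr → ℕ) : Type 1 := Quotient (PreTp.setoid ty)

namespace Tp

variable {Pr : Type} {ty : Pr → ℕ}

/-- The function `type : Tp(HL) → ℕ`. -/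
def type : Tp ty → ℕ :=
  Quotient.lift (fun T => T.1.rank ty) (fun _ _ h => PreTp.Equiv.rank_eq ty h)

/-- A raw representative of a type. -/
noncomputable def rep (T : Tp ty) : {T : PreTp Pr // T.WF ty} := Quotient.out T

theorem rank_rep (T : Tp ty) : T.rep.1.rank ty = T.type := by
  conv_rhs => rw [← Quotient.out_eq T]
  rfl

/-- A primitive type. -/
def prim (p : Pr) : Tp ty := Quotient.mk (PreTp.setoid ty) ⟨.prim p, trivial⟩

/-- The type `N ÷ D`. -/
noncomputable def div (N : Tp ty) (D : Denominator (type (ty := ty))) (h : N.type = D.gtype) :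
    Tp ty :=
  Quotient.mk (PreTp.setoid ty)
    ⟨.div N.rep.1 D.V D.E D.att (fun e => (D.lab e).rep.1) D.dollar D.ext,
      N.rep.2, fun e => (D.lab e).rep.2, D.finite_V, D.finite_E, D.att_nodup,
      fun e => (D.att_length e).trans (rank_rep _).symm, D.dollar_nodup, D.ext_nodup,
      (rank_rep N).trans h⟩

/-- The type `×(M)`. -/
noncomputable def times (M : HGraph (type (ty := ty))) : Tp ty :=
  Quotient.mk (PreTp.setoid ty)
    ⟨.times M.V M.E M.att (fun e => (M.lab e).rep.1) M.ext,
      fun e => (M.lab e).rep.2, M.finite_V, M.finite_E, M.att_nodup,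
      fun e => (M.att_length e).trans (rank_rep _).symm, M.ext_nodup⟩

theorem type_div (N : Tp ty) (D : Denominator (type (ty := ty))) (h : N.type = D.gtype) :
    (div N D h).type = D.dollar.length := rfl

theorem type_times (M : HGraph (type (ty := ty))) : (times M).type = M.gtype := rfl

end Tp

/-- Graphs labelled by types, i.e. the antecedents of sequents. -/
abbrev TGraph {Pr : Type} (ty : Pr → ℕ) : Type 1 := HGraph (Tp.type (ty := ty))

/-- `H → A` is a graph sequent. -/
def IsSequent {Pr : Type} {ty : Pr → ℕ} (H : TGraph ty) (A : Tp ty) : Prop :=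
  H.gtype = A.type

/-- If `H → A` is a sequent and the edge `e` of `G` is labelled by `A`, then `e` can be replaced
by `H`. -/
theorem IsSequent.gtype_eq {Pr : Type} {ty : Pr → ℕ} {H : TGraph ty} {A : Tp ty}
    (hH : IsSequent H A) {G : TGraph ty} {e : G.E} (he : G.lab e = A) :
    H.gtype = G.edgeType e :=
  hH.trans ((congrArg Tp.type he.symm).trans (G.att_length e).symm)

/-- The antecedent `H[e/D][d₀ := N ÷ D][d₁/H₁, …, d_k/H_k]` in the conclusion of `(÷ →)`, where
`lab(e) = N`, `d₀` is the `$`-edge of `D`, and `d` ranges over the other edges of `D`. -/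
noncomputable def divLeftGraph {Pr : Type} {ty : Pr → ℕ} (N : Tp ty)
    (D : Denominator (Tp.type (ty := ty))) (hND : N.type = D.gtype)
    (H : TGraph ty) (e : H.E) (he : H.lab e = N)
    (K : D.E → TGraph ty) (hK : ∀ d, IsSequent (K d) (D.lab d)) : TGraph ty :=
  (H.replaceEdge e (D.relabel (Tp.div N D hND) rfl)
      (IsSequent.gtype_eq (A := N) hND.symm he)).replaceAll
    (ι := D.E)
    ⟨fun d => Sum.inr ⟨(), some d⟩, fun _ _ h =>
      Option.some.inj (eq_of_heq (Sigma.mk.inj (Sum.inr.inj h)).2)⟩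
    K
    (fun d => (hK d).gtype_eq rfl)

/-- Derivability of a sequent in `HL` (for `withCut = False`) and in `HL` enriched with the cut
rule (for `withCut = True`). -/
inductive Derives {Pr : Type} (ty : Pr → ℕ) (withCut : Prop) : TGraph ty → Tp ty → Prop where
  /-- Isomorphic graphs are not distinguished. -/
  | iso {G G' : TGraph ty} {A : Tp ty} (hG : G.IsIso G') (h : Derives ty withCut G A) :
      Derives ty withCut G' A
  /-- The axiom `p^• → p`. -/
  | ax (p : Pr) : Derives ty withCut (HGraph.handle Tp.type (Tp.prim p)) (Tp.prim p)
  /-- The rule `(÷ →)`. -/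
  | div_left (N : Tp ty) (D : Denominator (Tp.type (ty := ty))) (hND : N.type = D.gtype)
      (H : TGraph ty) (A : Tp ty) (e : H.E) (he : H.lab e = N)
      (K : D.E → TGraph ty) (hK : ∀ d, IsSequent (K d) (D.lab d))
      (h : Derives ty withCut H A) (hs : ∀ d, Derives ty withCut (K d) (D.lab d)) :
      Derives ty withCut (divLeftGraph N D hND H e he K hK) A
  /-- The rule `(→ ÷)`. The graph `D[d₀/F]` is written `D[d₀ := N ÷ D][d₀/F]`; the label of an
  edge that is replaced has no influence on the result. -/
  | div_right (N : Tp ty) (D : Denominator (Tp.type (ty := ty))) (hND : N.type = D.gtype)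
      (F : TGraph ty) (hF : IsSequent F (Tp.div N D hND))
      (h : Derives ty withCut
        ((D.relabel (Tp.div N D hND) rfl).replaceEdge none F (hF.gtype_eq rfl)) N) :
      Derives ty withCut F (Tp.div N D hND)
  /-- The rule `(× →)`. -/
  | times_left (F G : TGraph ty) (A : Tp ty) (e : G.E) (he : G.lab e = Tp.times F)
      (h : Derives ty withCut
        (G.replaceEdge e F (IsSequent.gtype_eq (A := Tp.times F) rfl he)) A) :
      Derives ty withCut G A
  /-- The rule `(→ ×)`. -/
  | times_right (M : TGraph ty) (K : M.E → TGraph ty) (hK : ∀ m, IsSequent (K m) (M.lab m))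
      (hs : ∀ m, Derives ty withCut (K m) (M.lab m)) :
      Derives ty withCut
        (M.replaceAll (Function.Embedding.refl M.E) K (fun m => (hK m).gtype_eq rfl))
        (Tp.times M)
  /-- The rule `(cut)`, available only if `withCut` holds. -/
  | cut (hc : withCut) (H G : TGraph ty) (A B : Tp ty) (hHA : IsSequent H A)
      (e₀ : G.E) (he : G.lab e₀ = A)
      (hH : Derives ty withCut H A) (hG : Derives ty withCut G B) :
      Derives ty withCut (G.replaceEdge e₀ H (hHA.gtype_eq he)) B

/-- `HL ⊢ H → A`. -/
def HLDerivable {Pr : Type} (ty : Pr → ℕ) (H : TGraph ty) (A : Tp ty) : Prop :=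
  Derives ty False H A

/-- `H → A` is derivable in `HL` enriched with the cut rule. -/
def HLCutDerivable {Pr : Type} (ty : Pr → ℕ) (H : TGraph ty) (A : Tp ty) : Prop :=
  Derives ty True H A

/-! The proof is semantic: it uses a phase model built from cut-free derivability instead of
permuting rules. Each type `A` is interpreted by a set `A.sem` of graphs closed under
`biorthogonal`: a graph lies in the closure of `X` if it fits every one-edge context that becomes
cut-free derivable with each member of `X`. A primitive type receives its cut-free derivable
antecedents; `×(M)` the closure of all fillings of `M` by members; `N ÷ D` the graphs which, put for
the `$`-edge with members on the other edges of `D`, give a member of `N.sem`.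

Two facts meet. Soundness (`Derives.valid`): for a sequent derivable even with cut, filling all
edges of the antecedent with members of the interpretations of their labels yields a member of the
interpretation of the succedent. Cut causes no trouble, since a filling of a filling is a filling
(`HGraph.replaceAll_subst`). Adequacy (`Tp.handle_mem_sem_and_derivable`): the handle of `A` lies in
`A.sem`, and all members of `A.sem` are cut-free derivable antecedents of `A`. Filling `F` with the
handles of its own labels returns `F`, so soundness puts `F` in `B.sem`, and adequacy makes `F → B`
cut-free derivable. -/

/-! ### Isomorphism of graphs and the fusion map -/

namespace HGraph

variable {C : Type u} {ty : C → ℕ}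

theorem IsIso.refl (G : HGraph ty) : G.IsIso G :=
  ⟨.refl _, .refl _, by simp, by simp, by simp⟩

theorem IsIso.symm {G H : HGraph ty} : G.IsIso H → H.IsIso G := by
  rintro ⟨v, ε, hatt, hlab, hext⟩
  refine ⟨v.symm, ε.symm, fun e => ?_, fun e => ?_, by simp [hext]⟩
  · have := hatt (ε.symm e)
    simp only [Equiv.apply_symm_apply] at this
    simp [this]
  · simpa using (hlab (ε.symm e)).symm

theorem IsIso.trans {G H K : HGraph ty} : G.IsIso H → H.IsIso K → G.IsIso K := by
  rintro ⟨v, ε, hatt, hlab, hext⟩ ⟨v', ε', hatt', hlab', hext'⟩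
  exact ⟨v.trans v', ε.trans ε', by simp [hatt, hatt'], by simp [hlab, hlab'],
    by simp [hext, hext']⟩

theorem IsIso.of_eq {G H : HGraph ty} (h : G = H) : G.IsIso H := h ▸ IsIso.refl G

theorem IsIso.gtype_eq {G H : HGraph ty} : G.IsIso H → G.gtype = H.gtype := by
  rintro ⟨v, ε, hatt, hlab, hext⟩
  simp [gtype, hext]

theorem gtype_handle (a : C) : (handle ty a).gtype = ty a := List.length_finRange

theorem edgeType_eq (G : HGraph ty) (e : G.E) : G.edgeType e = ty (G.lab e) := G.att_length e

section Fuse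

variable (G : HGraph ty) {ι : Type} (ε : ι ↪ G.E) (H : ι → HGraph ty)
  (h : ∀ i, (H i).gtype = G.edgeType (ε i))

theorem map_fuse_ext (i : ι) :
    (H i).ext.map (G.fuse ε H h i) = (G.att (ε i)).map Sum.inl := by
  classical
  refine List.ext_getElem (by simpa [gtype, edgeType] using h i) fun k h1 h2 => ?_
  simp only [List.length_map] at h1 h2
  simp only [List.getElem_map, fuse, List.getElem_mem, dif_pos]
  congr
  exact (H i).ext_nodup.idxOf_getElem k h1

theorem fuse_of_notMem (i : ι) (v : (H i).V) (hv : v ∉ (H i).ext) :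
    G.fuse ε H h i v = Sum.inr ⟨i, ⟨v, hv⟩⟩ := by
  simp [fuse, hv]

/-- A map out of the nodes of a replacement may be computed on each inserted graph separately. -/
theorem apply_fuse {α : Type*} {i : ι} (φ : G.V ⊕ (Σ i, {v : (H i).V // v ∉ (H i).ext}) → α)
    (w : (H i).V → α) (hext : (H i).ext.map w = (G.att (ε i)).map fun x => φ (Sum.inl x))
    (hw : ∀ y (hy : y ∉ (H i).ext), φ (Sum.inr ⟨i, ⟨y, hy⟩⟩) = w y) (y : (H i).V) :
    φ (G.fuse ε H h i y) = w y := by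
  by_cases hy : y ∈ (H i).ext
  · have h1 : (H i).ext.map (fun y => φ (G.fuse ε H h i y)) = (H i).ext.map w := by
      have := congrArg (List.map φ) (G.map_fuse_ext ε H h i)
      rw [List.map_map, List.map_map] at this
      rw [hext]
      exact this
    exact List.map_inj_left.1 h1 y hy
  · rw [fuse_of_notMem _ _ _ _ _ _ hy, hw]

end Fuse

/-! ### Total substitution: recognition, invariance and unit laws -/

/-- Replacement of all edges of `G`. -/
noncomputable def subst (G : HGraph ty) (K : G.E → HGraph ty)
    (h : ∀ e, (K e).gtype = G.edgeType e) : HGraph ty where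
  V := G.V ⊕ (Σ e, {v : (K e).V // v ∉ (K e).ext})
  E := Σ e, (K e).E
  finite_V := by
    have := G.finite_V
    have := G.finite_E
    have := fun e => (K e).finite_V
    infer_instance
  finite_E := by
    have := G.finite_E
    have := fun e => (K e).finite_E
    infer_instance
  att f := ((K f.1).att f.2).map (G.fuse (.refl _) K h f.1)
  att_nodup f := ((K f.1).att_nodup f.2).map (G.fuse_injective (.refl _) K h f.1)
  lab f := (K f.1).lab f.2
  att_length f := by simpa using (K f.1).att_length f.2
  ext := G.ext.map Sum.inl
  ext_nodup := G.ext_nodup.map Sum.inl_injective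

theorem gtype_subst (G : HGraph ty) (K : G.E → HGraph ty)
    (h : ∀ e, (K e).gtype = G.edgeType e) : (G.subst K h).gtype = G.gtype := by
  simp [gtype, subst]

theorem gtype_replaceAll (G : HGraph ty) {ι : Type} (ε : ι ↪ G.E) (H : ι → HGraph ty)
    (h : ∀ i, (H i).gtype = G.edgeType (ε i)) : (G.replaceAll ε H h).gtype = G.gtype := by
  simp [gtype, replaceAll]

/-- A substitution is a gluing, so a map out of it amounts to maps `v` and `w e` that agree where
nodes are fused. Incidences can then be checked inside each `K e`, without deciding which nodes are
external. -/
theorem subst_isIso_of (G : HGraph ty) (K : G.E → HGraph ty)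
    (h : ∀ e, (K e).gtype = G.edgeType e) (R : HGraph ty) (v : G.V → R.V)
    (w : ∀ e, (K e).V → R.V) (t : (Σ e, (K e).E) → R.E) (ht : Function.Bijective t)
    (hvw : Function.Bijective
      (Sum.elim v fun p : Σ e, {y : (K e).V // y ∉ (K e).ext} => w p.1 p.2.1))
    (hext : R.ext = G.ext.map v) (hglue : ∀ e, (K e).ext.map (w e) = (G.att e).map v)
    (hatt : ∀ e f, R.att (t ⟨e, f⟩) = ((K e).att f).map (w e))
    (hlab : ∀ e f, R.lab (t ⟨e, f⟩) = (K e).lab f) : (G.subst K h).IsIso R := by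
  refine ⟨.ofBijective _ hvw, .ofBijective _ ht, ?_, fun f => hlab f.1 f.2, ?_⟩
  · rintro ⟨e, f⟩
    refine (hatt e f).trans (Eq.trans ?_ List.map_map.symm)
    refine List.map_congr_left fun y _ => ?_
    refine (G.apply_fuse (.refl _) K h (i := e) _ (w e) ?_ ?_ y).symm
    · exact hglue e
    · intro y hy
      rfl
  · rw [hext]
    simp only [subst, List.map_map]
    rfl

/-- Edge labels of `G` and `G'` do not matter here, since all edges are replaced. -/
theorem subst_congr' {G G' : HGraph ty} (v : G.V ≃ G'.V) (ε : G.E ≃ G'.E)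
    (hatt : ∀ e, G'.att (ε e) = (G.att e).map v) (hext : G'.ext = G.ext.map v)
    {K : G.E → HGraph ty} {K' : G'.E → HGraph ty} (h : ∀ e, (K e).gtype = G.edgeType e)
    (h' : ∀ e, (K' e).gtype = G'.edgeType e) (hK : ∀ e, (K e).IsIso (K' (ε e))) :
    (G.subst K h).IsIso (G'.subst K' h') := by
  choose w t hwatt hwlab hwext using hK
  have hmem : ∀ e y, y ∉ (K e).ext → w e y ∉ (K' (ε e)).ext := by
    intro e y hy
    rw [hwext]
    simpa using hy
  refine subst_isIso_of G K h _ (fun x => Sum.inl (v x))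
    (fun e y => G'.fuse (.refl _) K' h' (ε e) (w e y)) (fun f => ⟨ε f.1, t f.1 f.2⟩) ?_ ?_ ?_ ?_ ?_ ?_
  · exact (Equiv.sigmaCongr (β₁ := fun e => (K e).E) (β₂ := fun e => (K' e).E) ε t).bijective
  · let q : (G.V ⊕ (Σ e, {y : (K e).V // y ∉ (K e).ext})) ≃ (G'.subst K' h').V :=
      Equiv.sumCongr v (Equiv.sigmaCongr
        (β₁ := fun e => {y : (K e).V // y ∉ (K e).ext})
        (β₂ := fun e => {y : (K' e).V // y ∉ (K' e).ext}) ε fun e => (w e).subtypeEquiv fun y => by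
        rw [hwext]
        simp)
    convert q.bijective using 1
    funext x
    rcases x with x | ⟨e, y, hy⟩
    · rfl
    · exact fuse_of_notMem _ _ _ h' _ _ (hmem e y hy)
  · simp [subst, hext]
  · intro e
    have := G'.map_fuse_ext (.refl _) K' h' (ε e)
    rw [hwext, List.map_map] at this
    refine this.trans ?_
    simp only [Function.Embedding.refl_apply, hatt, List.map_map]
    rfl
  · intro e f
    simp [subst, hwatt]
  · intro e f
    exact hwlab e f

theorem subst_congr {G : HGraph ty} {K K' : G.E → HGraph ty}
    (h : ∀ e, (K e).gtype = G.edgeType e) (h' : ∀ e, (K' e).gtype = G.edgeType e)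
    (hK : ∀ e, (K e).IsIso (K' e)) : (G.subst K h).IsIso (G.subst K' h') :=
  subst_congr' (.refl _) (.refl _) (by simp) (by simp) h h' hK

/-- Right unit law: all nodes of a handle are external, so each inserted handle adds no node and
restores its edge. -/
theorem subst_handle (G : HGraph ty)
    (h : ∀ e, (handle ty (G.lab e)).gtype = G.edgeType e) :
    (G.subst (fun e => handle ty (G.lab e)) h).IsIso G := by
  have hw : ∀ e, (List.finRange (ty (G.lab e))).map
      (fun k => (G.att e)[k.1]'(by rw [G.att_length]; exact k.2)) = G.att e := fun e =>
    List.ext_getElem (by simp [G.att_length]) fun k h1 h2 => by simp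
  refine subst_isIso_of G _ h G id (fun e (k : Fin (ty (G.lab e))) => (G.att e)[k.1]'(by rw [G.att_length]; exact k.2))
    (fun f => f.1) ?_ ?_ (by simp) ?_ ?_ ?_
  · exact ⟨fun ⟨e, _⟩ ⟨e', _⟩ h => by cases h; rfl, fun e => ⟨⟨e, ()⟩, rfl⟩⟩
  · refine ⟨?_, fun x => ⟨.inl x, rfl⟩⟩
    rintro (x | ⟨e, y, hy⟩) (x' | ⟨e', y', hy'⟩) hxx
    · exact congrArg Sum.inl hxx
    · exact absurd (List.mem_finRange y') hy'
    · exact absurd (List.mem_finRange y) hy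
    · exact absurd (List.mem_finRange y) hy
  · intro e
    rw [List.map_id]
    exact hw e
  · intro e f
    exact (hw e).symm
  · intro e f
    rfl

/-- Left unit law: the nodes of the handle become the external nodes of the inserted graph. -/
theorem handle_subst (a : C) (K : Unit → HGraph ty)
    (h : ∀ e, (K e).gtype = (handle ty a).edgeType e) :
    ((handle ty a).subst K h).IsIso (K ()) := by
  have hl : (K ()).ext.length = ty a := (h ()).trans ((handle ty a).att_length ())
  have hm : (List.finRange (ty a)).map (fun k => (K ()).ext[k.1]'(by rw [hl]; exact k.2)) =
      (K ()).ext :=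
    List.ext_getElem (by simp [hl]) fun k h1 h2 => by simp
  refine subst_isIso_of (handle ty a) K h (K ()) (fun (k : Fin (ty a)) => (K ()).ext[k.1]'(by rw [hl]; exact k.2))
    (fun e y => y) (fun f => f.2) ?_ ?_ hm.symm ?_ ?_ ?_
  · exact ⟨fun ⟨_, _⟩ ⟨_, _⟩ h => by cases h; rfl, fun f => ⟨⟨(), f⟩, rfl⟩⟩
  · constructor
    · rintro (x | ⟨e, y, hy⟩) (x' | ⟨e', y', hy'⟩) hxx
      · have := ((K ()).ext_nodup.getElem_inj_iff).1 hxx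
        exact congrArg Sum.inl (Fin.ext this)
      · have hxx : (K ()).ext[x.1]'(by rw [hl]; exact x.2) = y' := hxx
        exact absurd (hxx ▸ List.getElem_mem _) hy'
      · have hxx : y = (K ()).ext[x'.1]'(by rw [hl]; exact x'.2) := hxx
        exact absurd (hxx ▸ List.getElem_mem _) hy
      · cases hxx
        rfl
    · intro y
      by_cases hy : y ∈ (K ()).ext
      · obtain ⟨k, hk, rfl⟩ := List.getElem_of_mem hy
        exact ⟨.inl ⟨k, by rw [← hl]; exact hk⟩, rfl⟩
      · exact ⟨.inr ⟨(), y, hy⟩, rfl⟩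
  · intro e
    exact (List.map_id _).trans hm.symm
  · intro e f
    exact (List.map_id _).symm
  · intro e f
    rfl

/-! ### Partial replacement versus total substitution; associativity -/

/-- Renaming the edges of `G` along a bijection. -/
def reindex (G : HGraph ty) {S : Type} (σ : S ≃ G.E) : HGraph ty where
  V := G.V
  E := S
  finite_V := G.finite_V
  finite_E := by
    have := G.finite_E
    exact Finite.of_equiv _ σ.symm
  att s := G.att (σ s)
  att_nodup s := G.att_nodup (σ s)
  lab s := G.lab (σ s)
  att_length s := G.att_length (σ s)
  ext := G.ext
  ext_nodup := G.ext_nodup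

section ReplaceAllSubst

variable (G : HGraph ty) {ι : Type} (ε : ι ↪ G.E) (H : ι → HGraph ty)
  (h : ∀ i, (H i).gtype = G.edgeType (ε i))

/-- The edges of `G`, split into those outside and those inside the range of `ε`. -/
noncomputable def splitEdges {E ι : Type} (ε : ι ↪ E) : {e : E // e ∉ Set.range ε} ⊕ ι ≃ E :=
  .ofBijective (Sum.elim Subtype.val ε) <| by
    constructor
    · rintro (⟨e, he⟩ | i) (⟨e', he'⟩ | i') hee
      · cases hee; rfl
      · exact absurd ⟨i', Eq.symm hee⟩ he
      · exact absurd ⟨i, hee⟩ he'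
      · exact congrArg Sum.inr (ε.injective hee)
    · intro e
      by_cases he : e ∈ Set.range ε
      · obtain ⟨i, rfl⟩ := he
        exact ⟨.inr i, rfl⟩
      · exact ⟨.inl ⟨e, he⟩, rfl⟩

/-- The core of associativity. Indexing the edges of `G` by a disjoint union lets the combined
family be a `Sum.elim`, so that no transport along membership in the range of `ε` occurs. -/
theorem subst_replaceAll_reindex (K : (G.replaceAll ε H h).E → HGraph ty)
    (hK : ∀ e, (K e).gtype = (G.replaceAll ε H h).edgeType e)
    (hK' : ∀ i f, (K (.inr ⟨i, f⟩)).gtype = (H i).edgeType f)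
    (hL : ∀ s, (Sum.elim (fun e => K (.inl e))
      (fun i => (H i).subst (fun f => K (.inr ⟨i, f⟩)) (hK' i)) s).gtype =
        (G.reindex (splitEdges ε)).edgeType s) :
    ((G.replaceAll ε H h).subst K hK).IsIso ((G.reindex (splitEdges ε)).subst _ hL) := by
  set L : {e : G.E // e ∉ Set.range ε} ⊕ ι → HGraph ty := Sum.elim (fun e => K (.inl e))
      (fun i => (H i).subst (fun f => K (.inr ⟨i, f⟩)) (hK' i))
  have hnm : ∀ i y, y ∉ (H i).ext → (Sum.inl y : (L (.inr i)).V) ∉ (L (.inr i)).ext := by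
    intro i y hy hy'
    obtain ⟨y', h1, h2⟩ := List.mem_map.1 hy'
    cases h2
    exact hy h1
  have hnm' : ∀ i p, (Sum.inr p : (L (.inr i)).V) ∉ (L (.inr i)).ext := by
    intro i y hy'
    obtain ⟨y', h1, h2⟩ := List.mem_map.1 hy'
    cases h2
  let R := (G.reindex (splitEdges ε)).subst L hL
  let φ := fun s => (G.reindex (splitEdges ε)).fuse (.refl _) L hL s
  let v : (G.replaceAll ε H h).V → R.V :=
    Sum.elim Sum.inl fun p => Sum.inr ⟨.inr p.1, ⟨Sum.inl p.2.1, hnm p.1 p.2.1 p.2.2⟩⟩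
  let ψ := fun i f => (H i).fuse (.refl _) (fun f => K (.inr ⟨i, f⟩)) (hK' i) f
  have hφ : ∀ s, (L s).ext.map (φ s) = (G.att (splitEdges ε s)).map Sum.inl :=
    fun s => map_fuse_ext _ _ _ hL s
  -- The two routes of a node of `H i` into the result, through `G[ε/H]` and through the filled copy
  -- of `H i`, coincide.
  have hv : ∀ i y, v (G.fuse ε H h i y) = φ (.inr i) (Sum.inl y) := by
    intro i
    refine apply_fuse _ _ _ _ _ _ ?_ ?_
    · have := hφ (.inr i)
      exact (List.map_map (f := Sum.inl) (g := φ (.inr i)) (l := (H i).ext)).symm.trans this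
    · intro y hy
      exact (fuse_of_notMem _ _ _ _ _ _ (hnm i y hy)).symm
  refine subst_isIso_of _ K hK R v
    (fun x => match x with
      | .inl e => φ (.inl e)
      | .inr ⟨i, f⟩ => fun y => φ (.inr i) (ψ i f y))
    (fun p => match p with
      | ⟨.inl e, g⟩ => ⟨.inl e, g⟩
      | ⟨.inr ⟨i, f⟩, g⟩ => ⟨.inr i, ⟨f, g⟩⟩) ?_ ?_ ?_ ?_ ?_ ?_
  · constructor
    · rintro ⟨e | ⟨i, f⟩, g⟩ ⟨e' | ⟨i', f'⟩, g'⟩ hgg <;> cases hgg <;> rfl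
    · rintro ⟨e | i, g⟩
      · exact ⟨⟨.inl e, g⟩, rfl⟩
      · exact ⟨⟨.inr ⟨i, g.1⟩, g.2⟩, rfl⟩
  · have h1 : ∀ e y (hy : y ∉ (K (.inl e)).ext),
        φ (.inl e) y = Sum.inr ⟨.inl e, ⟨y, hy⟩⟩ := fun e y hy =>
      fuse_of_notMem _ _ L hL (.inl e) y hy
    have h2 : ∀ i f y (hy : y ∉ (K (.inr ⟨i, f⟩)).ext), φ (.inr i) (ψ i f y) =
        Sum.inr ⟨.inr i, ⟨Sum.inr ⟨f, y, hy⟩, hnm' i _⟩⟩ := by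
      intro i f y hy
      have : ψ i f y = Sum.inr ⟨f, y, hy⟩ :=
        fuse_of_notMem (H i) (.refl _) (fun f => K (.inr ⟨i, f⟩)) (hK' i) f y hy
      rw [this]
      exact fuse_of_notMem _ _ _ _ _ _ (hnm' i _)
    -- The node map written out on constructors: bijectivity is then a case check, and `h1`, `h2`
    -- identify it with the map built from `fuse`.
    let F : (G.replaceAll ε H h).V ⊕
        (Σ x : (G.replaceAll ε H h).E, {y : (K x).V // y ∉ (K x).ext}) → R.V := fun x => match x with
      | .inl (.inl x) => Sum.inl x
      | .inl (.inr ⟨i, x⟩) => Sum.inr ⟨.inr i, ⟨Sum.inl x.1, hnm i x.1 x.2⟩⟩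
      | .inr ⟨.inl e, y⟩ => Sum.inr ⟨.inl e, y⟩
      | .inr ⟨.inr ⟨i, f⟩, y⟩ => Sum.inr ⟨.inr i, ⟨Sum.inr ⟨f, y⟩, hnm' i _⟩⟩
    have hF : Function.Bijective F := by
      constructor
      · rintro ((x | ⟨i, x, hx⟩) | ⟨e | ⟨i, f⟩, y, hy⟩)
          ((x' | ⟨i', x', hx'⟩) | ⟨e' | ⟨i', f'⟩, y', hy'⟩) hxx <;>
        cases hxx <;> rfl
      · rintro (x | ⟨e | i, y, hy⟩)
        · exact ⟨.inl (.inl x), rfl⟩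
        · exact ⟨.inr ⟨.inl e, y, hy⟩, rfl⟩
        · rcases y with y | ⟨f, y, hy'⟩
          · exact ⟨.inl (.inr ⟨i, y, fun hc => hy (List.mem_map.2 ⟨y, hc, rfl⟩)⟩), rfl⟩
          · exact ⟨.inr ⟨.inr ⟨i, f⟩, y, hy'⟩, rfl⟩
    refine (congrArg Function.Bijective (funext fun x => ?_)).mpr hF
    rcases x with (x | ⟨i, x, hx⟩) | ⟨e | ⟨i, f⟩, y, hy⟩
    · rfl
    · rfl
    · exact h1 e y hy
    · exact h2 i f y hy
  · exact (List.map_map (f := Sum.inl) (g := v) (l := G.ext)).symm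
  · rintro (e | ⟨i, f⟩)
    · exact (hφ (.inl e)).trans (List.map_map (f := Sum.inl) (g := v) (l := G.att e.1)).symm
    · have h1 := congrArg (List.map (φ (.inr i)))
        (map_fuse_ext _ (.refl _) (fun f => K (.inr ⟨i, f⟩)) (hK' i) f)
      refine (List.map_map.symm.trans (h1.trans List.map_map)).trans ?_
      refine Eq.trans ?_ (List.map_map (f := G.fuse ε H h i) (g := v) (l := (H i).att f)).symm
      exact List.map_congr_left fun y _ => (hv i y).symm
  · rintro (e | ⟨i, f⟩) g
    · rfl
    · exact List.map_map
  · rintro (e | ⟨i, f⟩) g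
    · rfl
    · rfl

theorem gtype_inr_of_replaceAll {K : (G.replaceAll ε H h).E → HGraph ty}
    (hK : ∀ e, (K e).gtype = (G.replaceAll ε H h).edgeType e) (i : ι) (f : (H i).E) :
    (K (.inr ⟨i, f⟩)).gtype = (H i).edgeType f :=
  (hK (.inr ⟨i, f⟩)).trans (List.length_map _)

/-- Associativity of replacement. -/
theorem replaceAll_subst {K : (G.replaceAll ε H h).E → HGraph ty}
    (hK : ∀ e, (K e).gtype = (G.replaceAll ε H h).edgeType e) {L : G.E → HGraph ty}
    (hL : ∀ e, (L e).gtype = G.edgeType e)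
    (hin : ∀ i, ((H i).subst (fun f => K (.inr ⟨i, f⟩))
      (G.gtype_inr_of_replaceAll ε H h hK i)).IsIso (L (ε i)))
    (hout : ∀ e (he : e ∉ Set.range ε), (K (.inl ⟨e, he⟩)).IsIso (L e)) :
    ((G.replaceAll ε H h).subst K hK).IsIso (G.subst L hL) := by
  have hL' : ∀ s, (Sum.elim (fun e => K (.inl e)) (fun i => (H i).subst
      (fun f => K (.inr ⟨i, f⟩)) (G.gtype_inr_of_replaceAll ε H h hK i)) s).IsIso
        (L (splitEdges ε s)) := by
    rintro (⟨e, he⟩ | i)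
    · exact hout e he
    · exact hin i
  refine (G.subst_replaceAll_reindex ε H h K hK (G.gtype_inr_of_replaceAll ε H h hK)
    fun s => (hL' s).gtype_eq.trans (hL _)).trans ?_
  exact subst_congr' (G := G.reindex (splitEdges ε)) (G' := G) (.refl G.V) (splitEdges ε)
    (fun e => (List.map_id _).symm) (List.map_id _).symm _ hL hL'

/-- Fill the replaced graph with handles, which changes nothing, and apply associativity. Leaving an
edge alone thus counts as substituting its handle. -/
theorem replaceAll_isIso_subst {L : G.E → HGraph ty} (hL : ∀ e, (L e).gtype = G.edgeType e)
    (hin : ∀ i, (H i).IsIso (L (ε i)))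
    (hout : ∀ e, e ∉ Set.range ε → (handle ty (G.lab e)).IsIso (L e)) :
    (G.replaceAll ε H h).IsIso (G.subst L hL) := by
  have hh : ∀ (G : HGraph ty) e, (handle ty (G.lab e)).gtype = G.edgeType e := fun G e =>
    (gtype_handle _).trans (G.edgeType_eq e).symm
  refine ((G.replaceAll ε H h).subst_handle (hh _)).symm.trans ?_
  exact G.replaceAll_subst ε H h _ hL (fun i => ((H i).subst_handle (hh _)).trans (hin i)) hout

end ReplaceAllSubst

/-! ### Replacement of single edges and nested replacement -/

theorem gtype_handle_lab (G : HGraph ty) (e : G.E) :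
    (handle ty (G.lab e)).gtype = G.edgeType e :=
  (gtype_handle _).trans (G.edgeType_eq e).symm

open Classical in
/-- The family replacing `e` by `H` and every other edge by its own handle. -/
noncomputable def single (G : HGraph ty) (e : G.E) (H : HGraph ty) : G.E → HGraph ty :=
  Function.update (fun e => handle ty (G.lab e)) e H

theorem single_self (G : HGraph ty) (e : G.E) (H : HGraph ty) : G.single e H e = H := by
  simp [single]

theorem single_of_ne (G : HGraph ty) {e e' : G.E} (h : e' ≠ e) (H : HGraph ty) :
    G.single e H e' = handle ty (G.lab e') := by
  simp [single, h]

theorem gtype_single (G : HGraph ty) (e : G.E) {H : HGraph ty} (h : H.gtype = G.edgeType e)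
    (e' : G.E) : (G.single e H e').gtype = G.edgeType e' := by
  by_cases he : e' = e
  · subst he
    rwa [single_self]
  · rw [single_of_ne G he, gtype_handle_lab]

theorem replaceEdge_isIso_subst (G : HGraph ty) (e : G.E) (H : HGraph ty)
    (h : H.gtype = G.edgeType e) {L : G.E → HGraph ty} (hL : ∀ e, (L e).gtype = G.edgeType e)
    (hin : H.IsIso (L e)) (hout : ∀ e', e' ≠ e → (handle ty (G.lab e')).IsIso (L e')) :
    (G.replaceEdge e H h).IsIso (G.subst L hL) :=
  G.replaceAll_isIso_subst _ _ _ hL (fun _ => hin) fun e' he' =>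
    hout e' fun hc => he' ⟨(), hc.symm⟩

theorem replaceEdge_isIso_single (G : HGraph ty) (e : G.E) (H : HGraph ty)
    (h : H.gtype = G.edgeType e) :
    (G.replaceEdge e H h).IsIso (G.subst (G.single e H) (G.gtype_single e h)) :=
  G.replaceEdge_isIso_subst e H h _ (.of_eq (single_self G e H).symm) fun _ he =>
    .of_eq (single_of_ne G he H).symm

theorem replaceEdge_congr (G : HGraph ty) (e : G.E) {H H' : HGraph ty} (hH : H.IsIso H')
    (h : H.gtype = G.edgeType e) (h' : H'.gtype = G.edgeType e) :
    (G.replaceEdge e H h).IsIso (G.replaceEdge e H' h') := by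
  refine .trans ?_ (G.replaceEdge_isIso_single e H' h').symm
  exact G.replaceEdge_isIso_subst e H h _ (hH.trans (.of_eq (single_self G e H').symm)) fun _ he =>
    .of_eq (single_of_ne G he H').symm

theorem replaceEdge_handle (G : HGraph ty) (e : G.E) (h) :
    (G.replaceEdge e (handle ty (G.lab e)) h).IsIso G :=
  (G.replaceEdge_isIso_subst e _ h G.gtype_handle_lab (.refl _) fun _ _ => .refl _).trans
    (G.subst_handle _)

theorem handle_replaceEdge (a : C) (H : HGraph ty) (h) :
    ((handle ty a).replaceEdge () H h).IsIso H :=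
  (replaceEdge_isIso_subst _ _ H h (L := fun _ => H) (fun _ => h) (.refl _)
    fun _ he => absurd rfl he).trans (handle_subst a _ _)

/-- Both sides are compared with total substitutions, using the family `U` that extends `K` by
handles. -/
theorem replaceEdge_replaceAll (P : HGraph ty) (e : P.E) (Q : HGraph ty)
    (hQ : Q.gtype = P.edgeType e) {ι : Type} (ε : ι ↪ Q.E) (ε' : ι ↪ (P.replaceEdge e Q hQ).E)
    (hε : ∀ i, ε' i = .inr ⟨(), ε i⟩) (K : ι → HGraph ty) (h h' h'') :
    ((P.replaceEdge e Q hQ).replaceAll ε' K h).IsIso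
      (P.replaceEdge e (Q.replaceAll ε K h') h'') := by
  classical
  have hUex : ∃ U : (P.replaceEdge e Q hQ).E → HGraph ty, (∀ i, U (ε' i) = K i) ∧
      ∀ f, f ∉ Set.range ε' → U f = handle ty ((P.replaceEdge e Q hQ).lab f) :=
    ⟨Function.extend ε' K fun f => handle ty ((P.replaceEdge e Q hQ).lab f),
      fun i => ε'.injective.extend_apply _ _ _, fun f hf => Function.extend_apply' _ _ _ hf⟩
  obtain ⟨U, hU, hU'⟩ := hUex
  have hUg : ∀ f, (U f).gtype = (P.replaceEdge e Q hQ).edgeType f := by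
    intro f
    by_cases hf : f ∈ Set.range ε'
    · obtain ⟨i, rfl⟩ := hf
      rw [hU, h]
    · rw [hU' f hf, gtype_handle_lab]
  refine (replaceAll_isIso_subst _ ε' K h hUg (fun i => .of_eq (hU i).symm)
    fun f hf => .of_eq (hU' f hf).symm).trans ?_
  refine .trans ?_ (P.replaceEdge_isIso_single e _ h'').symm
  refine P.replaceAll_subst _ _ _ hUg _ (fun _ => ?_) fun e' he' => ?_
  · refine .trans ?_ (.of_eq (single_self P e _).symm)
    refine (Q.replaceAll_isIso_subst ε K h' _ (fun i => .of_eq ?_) fun f hf => .of_eq ?_).symm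
    · rw [← hε, hU]
    · refine (hU' (.inr ⟨(), f⟩) ?_).symm
      rintro ⟨i, hi⟩
      rw [hε] at hi
      cases hi
      exact hf ⟨i, rfl⟩
  · have hne : e' ≠ e := fun hc => he' ⟨(), hc.symm⟩
    refine .of_eq ((hU' (.inl ⟨e', he'⟩) ?_).trans (single_of_ne P hne _).symm)
    rintro ⟨i, hi⟩
    rw [hε] at hi
    cases hi

theorem replaceEdge_replaceEdge (P : HGraph ty) (e : P.E) (Q : HGraph ty)
    (hQ : Q.gtype = P.edgeType e) (e' : Q.E) (H : HGraph ty) (h h' h'') :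
    ((P.replaceEdge e Q hQ).replaceEdge (.inr ⟨(), e'⟩) H h).IsIso
      (P.replaceEdge e (Q.replaceEdge e' H h') h'') :=
  P.replaceEdge_replaceAll e Q hQ _ _ (fun _ => rfl) _ _ _ _

/-- A total substitution can be done with the edge `e` last. This exhibits it as a one-edge context,
the form that `biorthogonal` tests. -/
theorem replaceAll_replaceEdge (G : HGraph ty) {ι : Type} (ε : ι ↪ G.E) (K : ι → HGraph ty)
    (h : ∀ i, (K i).gtype = G.edgeType (ε i)) (e : G.E) (he : e ∉ Set.range ε)
    (hr : ∀ e', e' ∉ Set.range ε → e' = e) (H : HGraph ty) (hH) {L : G.E → HGraph ty}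
    (hL : ∀ e, (L e).gtype = G.edgeType e) (hin : H.IsIso (L e)) (hK : ∀ i, (K i).IsIso (L (ε i))) :
    ((G.replaceAll ε K h).replaceEdge (.inl ⟨e, he⟩) H hH).IsIso (G.subst L hL) := by
  refine (replaceEdge_isIso_single _ _ H hH).trans ?_
  refine G.replaceAll_subst ε K h _ hL (fun i => ?_) fun e' he' => ?_
  · refine .trans ?_ ((subst_handle (K i) (gtype_handle_lab _)).trans (hK i))
    refine subst_congr _ _ fun f => .of_eq ?_
    exact single_of_ne (G.replaceAll ε K h) Sum.inr_ne_inl H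
  · obtain rfl := hr e' he'
    exact (IsIso.of_eq (single_self _ _ _)).trans hin

end HGraph

/-! ### The closure operator defined by derivability in contexts -/

section Semantics

variable {Pr : Type} {ty : Pr → ℕ}

theorem Derives.isSequent {c : Prop} {G : TGraph ty} {A : Tp ty} (h : Derives ty c G A) :
    IsSequent G A := by
  induction h with
  | iso hG _ ih => exact hG.gtype_eq.symm.trans ih
  | ax p => exact HGraph.gtype_handle _
  | div_left N D hND H A e he K hK h hs ih ihs =>
    exact (HGraph.gtype_replaceAll _ _ _ _).trans ((HGraph.gtype_replaceAll _ _ _ _).trans ih)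
  | div_right N D hND F hF h ih => exact hF
  | times_left F G A e he h ih => exact (HGraph.gtype_replaceAll _ _ _ _).symm.trans ih
  | times_right M K hK hs ih => exact HGraph.gtype_replaceAll _ _ _ _
  | cut hc H G A B hHA e₀ he hH hG ihH ihG => exact (HGraph.gtype_replaceAll _ _ _ _).trans ihG

/-- The graphs that may be put for an edge labelled `A` in every derivable sequent into which all
elements of `X` may be put. -/
def biorthogonal (A : Tp ty) (X : Set (TGraph ty)) : Set (TGraph ty) :=
  {H | IsSequent H A ∧ ∀ (P : TGraph ty) (e : P.E) (B : Tp ty) (he : P.lab e = A),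
    (∀ H' ∈ X, ∀ h : IsSequent H' A, HLDerivable ty (P.replaceEdge e H' (h.gtype_eq he)) B) →
      ∀ h : IsSequent H A, HLDerivable ty (P.replaceEdge e H (h.gtype_eq he)) B}

theorem biorthogonal_idem {A : Tp ty} {X : Set (TGraph ty)} :
    biorthogonal A (biorthogonal A X) ⊆ biorthogonal A X := fun _ hH =>
  ⟨hH.1, fun P e B he hX => hH.2 P e B he fun _ hH' => hH'.2 P e B he hX⟩

theorem mem_biorthogonal_of_isIso {A : Tp ty} {X : Set (TGraph ty)} {H H' : TGraph ty}
    (hH : H ∈ X) (hA : IsSequent H A) (hHH : H.IsIso H') : H' ∈ biorthogonal A X :=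
  ⟨hHH.gtype_eq.symm.trans hA, fun P e _ _ hX _ =>
    .iso (P.replaceEdge_congr e hHH _ _) (hX H hH hA)⟩

/-- Test against the trivial context, the handle of `A`. -/
theorem derivable_of_mem_biorthogonal {A : Tp ty} {X : Set (TGraph ty)}
    (hX : ∀ H ∈ X, HLDerivable ty H A) {H : TGraph ty} (hH : H ∈ biorthogonal A X) :
    HLDerivable ty H A :=
  .iso (HGraph.handle_replaceEdge A H _) (hH.2 (.handle _ A) () A rfl (fun H' hH' _ =>
    .iso (HGraph.handle_replaceEdge A H' _).symm (hX H' hH')) hH.1)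

/-- To map a closure into a closed set by plugging into `Q`, it suffices to treat the generators: a
test context `P` for the result, with `Q` inserted, is itself a test context for `H`. -/
theorem replaceEdge_mem_of_mem_biorthogonal {A B : Tp ty} {X Y : Set (TGraph ty)}
    (hY : biorthogonal B Y ⊆ Y) {Q : TGraph ty} (hQ : IsSequent Q B) {e : Q.E} (he : Q.lab e = A)
    {H : TGraph ty} (hH : H ∈ biorthogonal A X)
    (hX : ∀ H' ∈ X, ∀ h : IsSequent H' A, Q.replaceEdge e H' (h.gtype_eq he) ∈ Y) :
    Q.replaceEdge e H (hH.1.gtype_eq he) ∈ Y := by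
  refine hY ⟨(HGraph.gtype_replaceAll _ _ _ _).trans hQ, fun P e' C he' hPY h => ?_⟩
  refine .iso (P.replaceEdge_replaceEdge e' Q (hQ.gtype_eq he') e H
    (hH.1.gtype_eq (G := P.replaceEdge e' Q _) he) _ _)
    (hH.2 (P.replaceEdge e' Q (hQ.gtype_eq he')) (.inr ⟨(), e⟩) C he (fun H' hH' h' => ?_) hH.1)
  have hQ' : IsSequent (Q.replaceEdge e H' (h'.gtype_eq he)) B :=
    (HGraph.gtype_replaceAll _ _ _ _).trans hQ
  exact .iso (P.replaceEdge_replaceEdge e' Q (hQ.gtype_eq he') e H' _ _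
    (hQ'.gtype_eq he')).symm (hPY _ (hX H' hH' h') hQ')

/-! ### Interpretation of raw types -/

namespace PreTp

/-- The type of a well-formed raw type. -/
def toTp (T : PreTp Pr) (h : T.WF ty) : Tp ty := Quotient.mk (PreTp.setoid ty) ⟨T, h⟩

/-- The denominator `D` of a raw type `N ÷ D`. -/
def denominator {N : PreTp Pr} {V E : Type} {att : E → List V} {lab : E → PreTp Pr}
    {dollar ext : List V} (h : (div N V E att lab dollar ext).WF ty) :
    Denominator (Tp.type (ty := ty)) where
  V := V
  E := E
  finite_V := h.2.2.1
  finite_E := h.2.2.2.1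
  att := att
  att_nodup := h.2.2.2.2.1
  lab e := (lab e).toTp (h.2.1 e)
  att_length := h.2.2.2.2.2.1
  ext := ext
  ext_nodup := h.2.2.2.2.2.2.2.1
  dollar := dollar
  dollar_nodup := h.2.2.2.2.2.2.1

/-- The graph `M` of a raw type `×(M)`. -/
def graph {V E : Type} {att : E → List V} {lab : E → PreTp Pr} {ext : List V}
    (h : (times V E att lab ext).WF ty) : TGraph ty where
  V := V
  E := E
  finite_V := h.2.1
  finite_E := h.2.2.1
  att := att
  att_nodup := h.2.2.2.1
  lab e := (lab e).toTp (h.1 e)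
  att_length := h.2.2.2.2.1
  ext := ext
  ext_nodup := h.2.2.2.2.2

/-- The graphs of which `T` holds in the canonical phase model of `HL`. -/
def sem : (T : PreTp Pr) → T.WF ty → Set (TGraph ty)
  | prim p, _ => {H | HLDerivable ty H (Tp.prim p)}
  | div N V E att lab dollar ext, h =>
    {F | IsSequent F ((div N V E att lab dollar ext).toTp h) ∧
      ∀ K : E → TGraph ty, (∀ d, K d ∈ (lab d).sem (h.2.1 d)) → ∀ hK,
        ((denominator h).relabel ((div N V E att lab dollar ext).toTp h) rfl).subst
          (fun o : Option E => o.elim F K) hK ∈ N.sem h.1}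
  | times V E att lab ext, h =>
    biorthogonal ((times V E att lab ext).toTp h)
      {H | ∃ (K : E → TGraph ty) (hK : _), (∀ e, K e ∈ (lab e).sem (h.1 e)) ∧
        ((graph h).subst K hK).IsIso H}

theorem isSequent_of_mem_sem {T : PreTp Pr} {h : T.WF ty} {H : TGraph ty} (hH : H ∈ T.sem h) :
    IsSequent H (T.toTp h) := by
  cases T with
  | prim p => exact Derives.isSequent (c := False) hH
  | div N V E att lab dollar ext => exact hH.1
  | times V E att lab ext => exact hH.1

/-- For `÷`, fix the graphs on the ordinary edges of `D`; what remains is a context with the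
`$`-edge as its hole, and closedness is inherited from that of `N`. -/
theorem biorthogonal_sem_subset (T : PreTp Pr) (h : T.WF ty) :
    biorthogonal (T.toTp h) (T.sem h) ⊆ T.sem h := by
  induction T with
  | prim p => exact fun H hH => derivable_of_mem_biorthogonal (fun _ h => h) hH
  | div N V E att lab dollar ext ihN ih =>
    refine fun F hF => ⟨hF.1, fun K hKsem hK => ?_⟩
    set D := denominator h
    set A := (div N V E att lab dollar ext).toTp h
    have hK' : ∀ d, (K d).gtype = (D.relabel A rfl).edgeType (Function.Embedding.some d) :=
      fun d => hK (some d)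
    have he : none ∉ Set.range (Function.Embedding.some (α := E)) := by simp
    have hr : ∀ o, o ∉ Set.range (Function.Embedding.some (α := E)) → o = none := by
      rintro (_ | d) ho
      · rfl
      · exact absurd ⟨d, rfl⟩ ho
    have hiso : ∀ F h1 h2, (((D.relabel A rfl).replaceAll Function.Embedding.some K hK').replaceEdge
        (.inl ⟨none, he⟩) F h1).IsIso
          ((D.relabel A rfl).subst (fun o : Option E => o.elim F K) h2) := fun F h1 h2 =>
      (D.relabel A rfl).replaceAll_replaceEdge _ K hK' none he hr F h1 h2 (.refl _)
        fun _ => .refl _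
    have hN : ∀ {H H' : TGraph ty}, H.IsIso H' → H ∈ N.sem h.1 → H' ∈ N.sem h.1 :=
      fun hi hH => ihN h.1 (mem_biorthogonal_of_isIso hH (isSequent_of_mem_sem hH) hi)
    refine hN (hiso F _ _) (replaceEdge_mem_of_mem_biorthogonal (ihN h.1) (A := A) ?_ rfl hF ?_)
    · exact (HGraph.gtype_replaceAll _ _ _ _).trans h.2.2.2.2.2.2.2.2.symm
    · intro F' hF' h'
      refine hN (hiso F' _ ?_).symm (hF'.2 K hKsem ?_)
      all_goals
        rintro (_ | d)
        · exact h'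
        · exact hK (some d)
  | times V E att lab ext ih => exact biorthogonal_idem

theorem mem_sem_of_isIso {T : PreTp Pr} {h : T.WF ty} {H H' : TGraph ty} (hi : H.IsIso H')
    (hH : H ∈ T.sem h) : H' ∈ T.sem h :=
  biorthogonal_sem_subset T h (mem_biorthogonal_of_isIso hH (isSequent_of_mem_sem hH) hi)

/-- Families are transported along the edge bijection. The resulting fillings are only isomorphic,
which suffices because interpretations are invariant under isomorphism. -/
theorem Equiv.sem_eq {S T : PreTp Pr} (hST : Equiv S T) (hS : S.WF ty) (hT : T.WF ty) :
    S.sem hS = T.sem hT := by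
  induction hST with
  | prim p => rfl
  | @div N N' V V' E E' att att' lab lab' dollar ext dollar' ext' hN v ε hatt hlab hd hx ihN ih =>
    have hA : toTp _ hS = toTp _ hT :=
      Quotient.sound (s := PreTp.setoid ty) (Equiv.div hN v ε hatt hlab hd hx)
    have hiso : ∀ (F : TGraph ty) (K : E → TGraph ty) (K' : E' → TGraph ty) hK hK',
        (∀ d, K d = K' (ε d)) →
        (((denominator hS).relabel (toTp _ hS) rfl).subst (fun o : Option E => o.elim F K) hK).IsIso
          (((denominator hT).relabel (toTp _ hT) rfl).subst
            (fun o : Option E' => o.elim F K') hK') := by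
      intro F K K' hK hK' hKK
      refine HGraph.subst_congr' (G := (denominator hS).relabel (toTp _ hS) rfl)
        (G' := (denominator hT).relabel (toTp _ hT) rfl) v ε.optionCongr ?_ hx _ _ ?_
      · rintro (_ | d)
        · exact hd
        · exact hatt d
      · rintro (_ | d)
        · exact .refl _
        · exact .of_eq (hKK d)
    ext F
    constructor
    · rintro ⟨hF, hF'⟩
      refine ⟨hA ▸ hF, fun K hKsem hK => ?_⟩
      have hg : ∀ d, (K (ε d)).gtype = (att d).length := fun d => by
        have := hK (some (ε d))
        refine this.trans ((congrArg List.length (hatt d)).trans (List.length_map _))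
      have hK0 : ∀ o, ((fun o : Option E => o.elim F (K ∘ ε)) o).gtype =
          ((denominator hS).relabel (toTp _ hS) rfl).edgeType o := by
        rintro (_ | d)
        · exact hF
        · exact hg d
      rw [← ihN hS.1 hT.1]
      refine mem_sem_of_isIso (hiso F (K ∘ ε) K hK0 hK fun _ => rfl) (hF' _ (fun d => ?_) hK0)
      rw [ih d (hS.2.1 d) (hT.2.1 (ε d))]
      exact hKsem (ε d)
    · rintro ⟨hF, hF'⟩
      refine ⟨hA ▸ hF, fun K hKsem hK => ?_⟩
      have hg : ∀ d, (K d).gtype = (att' (ε d)).length := fun d => by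
        have := hK (some d)
        exact this.trans ((congrArg List.length (hatt d)).trans (List.length_map _)).symm
      have hK0 : ∀ o, ((fun o : Option E' => o.elim F (K ∘ ε.symm)) o).gtype =
          ((denominator hT).relabel (toTp _ hT) rfl).edgeType o := by
        rintro (_ | d)
        · exact hF
        · obtain ⟨d, rfl⟩ := ε.surjective d
          refine Eq.trans (congrArg (fun d => (K d).gtype) (ε.symm_apply_apply d)) (hg d)
      rw [ihN hS.1 hT.1]
      refine mem_sem_of_isIso (hiso F K (K ∘ ε.symm) hK hK0 (by simp)).symm
        (hF' _ (fun d => ?_) hK0)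
      obtain ⟨d, rfl⟩ := ε.surjective d
      rw [← ih d (hS.2.1 d) (hT.2.1 (ε d))]
      simpa using hKsem d
  | @times V V' E E' att att' lab lab' ext ext' v ε hatt hlab hx ih =>
    have hA : toTp _ hS = toTp _ hT :=
      Quotient.sound (s := PreTp.setoid ty) (Equiv.times v ε hatt hlab hx)
    simp only [sem]
    rw [hA]
    congr 1
    ext H
    constructor
    · rintro ⟨K, hK, hKsem, hi⟩
      have hK0 : ∀ d, (K (ε.symm d)).gtype = (graph hT).edgeType d := by
        intro d
        obtain ⟨d, rfl⟩ := ε.surjective d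
        rw [ε.symm_apply_apply]
        exact (hK d).trans ((congrArg List.length (hatt d)).trans (List.length_map _)).symm
      refine ⟨K ∘ ε.symm, hK0, fun d => ?_, .trans (.symm ?_) hi⟩
      · obtain ⟨d, rfl⟩ := ε.surjective d
        rw [← ih d (hS.1 d) (hT.1 (ε d))]
        simpa using hKsem d
      · exact HGraph.subst_congr' (G := graph hS) (G' := graph hT) v ε hatt hx _ _
          fun d => .of_eq (congrArg K (ε.symm_apply_apply d).symm)
    · rintro ⟨K, hK, hKsem, hi⟩
      have hK0 : ∀ d, (K (ε d)).gtype = (graph hS).edgeType d := fun d =>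
        (hK (ε d)).trans ((congrArg List.length (hatt d)).trans (List.length_map _))
      refine ⟨K ∘ ε, hK0, fun d => ?_, .trans ?_ hi⟩
      · rw [ih d (hS.1 d) (hT.1 (ε d))]
        exact hKsem (ε d)
      · exact HGraph.subst_congr' (G := graph hS) (G' := graph hT) v ε hatt hx _ _
          fun d => .refl _

end PreTp

/-! ### Interpretation of types and induction on types -/

namespace Tp

/-- The graphs of which `A` holds in the canonical phase model of `HL`. -/
def sem : Tp ty → Set (TGraph ty) :=
  Quotient.lift (fun T => T.1.sem T.2) fun S T h => PreTp.Equiv.sem_eq h S.2 T.2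

theorem sem_rep (A : Tp ty) : A.rep.1.sem A.rep.2 = A.sem := by
  conv_rhs => rw [← Quotient.out_eq A]
  rfl

theorem isSequent_of_mem_sem {A : Tp ty} {H : TGraph ty} (hH : H ∈ A.sem) : IsSequent H A := by
  induction A using Quotient.ind
  exact PreTp.isSequent_of_mem_sem hH

theorem biorthogonal_sem_subset (A : Tp ty) : biorthogonal A A.sem ⊆ A.sem := by
  induction A using Quotient.ind with
  | _ T => exact PreTp.biorthogonal_sem_subset T.1 T.2

theorem mem_sem_of_isIso {A : Tp ty} {H H' : TGraph ty} (hi : H.IsIso H') (hH : H ∈ A.sem) :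
    H' ∈ A.sem :=
  biorthogonal_sem_subset A (mem_biorthogonal_of_isIso hH (isSequent_of_mem_sem hH) hi)

theorem mem_sem_div {N : Tp ty} {D : Denominator (type (ty := ty))} {h : N.type = D.gtype}
    {F : TGraph ty} : F ∈ (div N D h).sem ↔ IsSequent F (div N D h) ∧
      ∀ K : D.E → TGraph ty, (∀ d, K d ∈ (D.lab d).sem) → ∀ hK,
        (D.relabel (div N D h) rfl).subst (fun o : Option D.E => o.elim F K) hK ∈ N.sem := by
  simp only [← sem_rep N, ← sem_rep (D.lab _)]
  rfl

theorem sem_times (M : TGraph ty) : (times M).sem = biorthogonal (times M)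
    {H | ∃ (K : M.E → TGraph ty) (hK : _), (∀ e, K e ∈ (M.lab e).sem) ∧
      (M.subst K hK).IsIso H} := by
  simp only [← sem_rep (M.lab _)]
  rfl

/-- `div` and `times` choose representatives of the labels, so a raw constructor matches them only
up to `PreTp.Equiv`; equality holds in the quotient. -/
theorem induction {P : Tp ty → Prop} (hprim : ∀ p, P (prim p))
    (hdiv : ∀ N D h, P N → (∀ d, P (D.lab d)) → P (div N D h))
    (htimes : ∀ M, (∀ m, P (M.lab m)) → P (times M)) (A : Tp ty) : P A := by
  induction A using Quotient.ind with
  | _ T =>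
  obtain ⟨T, h⟩ := T
  induction T with
  | prim p => exact hprim p
  | div N V E att lab dollar ext ihN ih =>
    have := hdiv (N.toTp h.1) (PreTp.denominator h) h.2.2.2.2.2.2.2.2 (ihN h.1)
      fun d => ih d (h.2.1 d)
    have heq : (PreTp.div N V E att lab dollar ext).toTp h =
        div (N.toTp h.1) (PreTp.denominator h) h.2.2.2.2.2.2.2.2 :=
      Quotient.sound (s := PreTp.setoid ty) (PreTp.Equiv.div
      (PreTp.Equiv.symm' (Quotient.mk_out (s := PreTp.setoid ty) ⟨N, h.1⟩)) (.refl _) (.refl _)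
      (fun _ => (List.map_id _).symm)
      (fun d => PreTp.Equiv.symm' (Quotient.mk_out (s := PreTp.setoid ty) ⟨lab d, h.2.1 d⟩))
      (List.map_id _).symm (List.map_id _).symm)
    exact Eq.mpr (congrArg P heq) this
  | times V E att lab ext ih =>
    have := htimes (PreTp.graph h) fun d => ih d (h.1 d)
    have heq : (PreTp.times V E att lab ext).toTp h = times (PreTp.graph h) :=
      Quotient.sound (s := PreTp.setoid ty) (PreTp.Equiv.times (.refl _) (.refl _)
      (fun _ => (List.map_id _).symm)
      (fun d => PreTp.Equiv.symm' (Quotient.mk_out (s := PreTp.setoid ty) ⟨lab d, h.1 d⟩))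
      (List.map_id _).symm)
    exact Eq.mpr (congrArg P heq) this

end Tp

end Semantics

/-! ### Adequacy, soundness and cut elimination -/

section CutElimination

variable {Pr : Type} {ty : Pr → ℕ}

/-- The canonical phase model is contained in derivability. -/
theorem Tp.handle_mem_sem_and_derivable (A : Tp ty) :
    HGraph.handle Tp.type A ∈ A.sem ∧ ∀ H ∈ A.sem, HLDerivable ty H A := by
  induction A using Tp.induction with
  | hprim p => exact ⟨.ax p, fun H hH => hH⟩
  | hdiv N D h ihN ih =>
    constructor
    · refine mem_sem_div.2 ⟨HGraph.gtype_handle _, fun K hKsem hK => ?_⟩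
      have hKseq : ∀ d, IsSequent (K d) (D.lab d) := fun d => isSequent_of_mem_sem (hKsem d)
      -- As `N.sem` is closed, only a test context `P` for `N` matters. The handle of `N` is a
      -- member, so `P` itself is derivable, and `(÷ →)` applied to `P` gives the required sequent.
      refine biorthogonal_sem_subset N
        ⟨(HGraph.gtype_subst _ _ _).trans h.symm, fun P e B he hN hs => ?_⟩
      subst he
      have hP : HLDerivable ty P B := .iso (P.replaceEdge_handle e _)
        (hN _ ihN.1 (isSequent_of_mem_sem ihN.1))
      have hr : ∀ d, (K d).gtype = (D.relabel (div (P.lab e) D h) rfl).edgeType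
          (Function.Embedding.some d) := fun d => hK (some d)
      refine .iso (.trans (P.replaceEdge_replaceAll e (D.relabel (div (P.lab e) D h) rfl)
        (IsSequent.gtype_eq h.symm rfl) Function.Embedding.some _ (fun _ => rfl) K _ hr
        ((HGraph.gtype_replaceAll _ _ _ _).trans (IsSequent.gtype_eq h.symm rfl))) ?_)
        (.div_left (P.lab e) D h P B e rfl K hKseq hP fun d => (ih d).2 _ (hKsem d))
      refine P.replaceEdge_congr e ((D.relabel (div (P.lab e) D h) rfl).replaceAll_isIso_subst
        Function.Embedding.some K hr hK (fun _ => .refl _) ?_) _ _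
      rintro (_ | d) ho
      · exact .refl _
      · exact absurd ⟨d, rfl⟩ ho
    · intro F hF
      obtain ⟨hF, hF'⟩ := mem_sem_div.1 hF
      have hg : ∀ o, ((fun o : Option D.E => o.elim F fun d => HGraph.handle Tp.type (D.lab d)) o).gtype
          = (D.relabel (div N D h) rfl).edgeType o := by
        rintro (_ | d)
        · exact hF
        · exact D.gtype_handle_lab d
      -- Handles on the ordinary edges of `D` turn the semantic condition into the premise of `(→
      -- ÷)`.
      refine .div_right N D h F hF (.iso (.symm ?_) (ihN.2 _ (hF' _ (fun d => (ih d).1) hg)))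
      refine HGraph.replaceEdge_isIso_subst _ _ F _ _ (.refl _) ?_
      rintro (_ | d) ho
      · exact absurd rfl ho
      · exact .refl _
  | htimes M ih =>
    rw [sem_times]
    constructor
    · refine ⟨HGraph.gtype_handle _, fun P e B he hM hs => ?_⟩
      -- `M`, filled with handles, is one of the generators, so the context accepts it; this is the
      -- premise of `(× →)`.
      have hP : HLDerivable ty P B := .times_left M P B e he
        (hM M ⟨_, M.gtype_handle_lab, fun m => (ih m).1, M.subst_handle _⟩ rfl)
      refine .iso (.symm ?_) hP
      simp only [← he]
      exact P.replaceEdge_handle e _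
    · refine fun H hH => derivable_of_mem_biorthogonal ?_ hH
      rintro H' ⟨K, hK, hKsem, hi⟩
      refine .iso (.trans ?_ hi) (.times_right M K (fun m => isSequent_of_mem_sem (hKsem m))
        fun m => (ih m).2 _ (hKsem m))
      exact M.replaceAll_isIso_subst _ _ _ _ (fun _ => .refl _) fun m hm => absurd ⟨m, rfl⟩ hm

/-- Validity of the sequent `F → B` in the canonical phase model. -/
def Valid (F : TGraph ty) (B : Tp ty) : Prop :=
  ∀ K : F.E → TGraph ty, (∀ e, K e ∈ (F.lab e).sem) → ∀ hK, F.subst K hK ∈ B.sem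

/-- The semantic form of cut: fill each `H i` first, then fill `G` with the results. It also yields
soundness of `(÷ →)` and `(→ ×)`, which are cuts against `valid_relabel` and `valid_times`. -/
theorem Valid.replaceAll {G : TGraph ty} {B : Tp ty} (hG : Valid G B) {ι : Type} (ε : ι ↪ G.E)
    (H : ι → TGraph ty) (h) (hH : ∀ i, Valid (H i) (G.lab (ε i))) :
    Valid (G.replaceAll ε H h) B := by
  intro K hKsem hK
  set L' : {e : G.E // e ∉ Set.range ε} ⊕ ι → TGraph ty := Sum.elim (fun e => K (.inl e))
    (fun i => (H i).subst (fun f => K (.inr ⟨i, f⟩)) (G.gtype_inr_of_replaceAll ε H h hK i))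
  have hLsem' : ∀ s, L' s ∈ (G.lab (HGraph.splitEdges ε s)).sem := by
    rintro (e | i)
    · exact hKsem (.inl e)
    · exact hH i _ (fun f => hKsem (.inr ⟨i, f⟩)) _
  have hLsem : ∀ e, L' ((HGraph.splitEdges ε).symm e) ∈ (G.lab e).sem := fun e => by
    simpa using hLsem' ((HGraph.splitEdges ε).symm e)
  have hL : ∀ e, (L' ((HGraph.splitEdges ε).symm e)).gtype = G.edgeType e := fun e =>
    (Tp.isSequent_of_mem_sem (hLsem e)).gtype_eq rfl
  have hs : ∀ s, L' ((HGraph.splitEdges ε).symm (HGraph.splitEdges ε s)) = L' s := fun s => by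
    rw [Equiv.symm_apply_apply]
  refine Tp.mem_sem_of_isIso (.symm ?_) (hG _ hLsem hL)
  exact G.replaceAll_subst ε H h hK hL (fun i => .of_eq (hs (.inr i)).symm)
    fun e he => .of_eq (hs (.inl ⟨e, he⟩)).symm

theorem Valid.replaceEdge {G : TGraph ty} {B : Tp ty} (hG : Valid G B) (e : G.E) {H : TGraph ty}
    (h) (hH : Valid H (G.lab e)) : Valid (G.replaceEdge e H h) B :=
  hG.replaceAll _ _ _ fun _ => hH

theorem Valid.of_isIso {G G' : TGraph ty} {B : Tp ty} (hi : G.IsIso G') (hG : Valid G B) :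
    Valid G' B := by
  obtain ⟨v, ε, hatt, hlab, hext⟩ := hi
  intro K hKsem hK
  have hKsem' : ∀ e, K (ε e) ∈ (G.lab e).sem := fun e => hlab e ▸ hKsem (ε e)
  exact Tp.mem_sem_of_isIso (HGraph.subst_congr' v ε hatt hext _ hK fun _ => .refl _)
    (hG (K ∘ ε) hKsem' fun e => (Tp.isSequent_of_mem_sem (hKsem' e)).gtype_eq rfl)

theorem valid_handle (A : Tp ty) : Valid (HGraph.handle Tp.type A) A := fun K hKsem hK =>
  Tp.mem_sem_of_isIso (HGraph.handle_subst A K hK).symm (hKsem ())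

theorem valid_relabel (N : Tp ty) (D : Denominator (Tp.type (ty := ty))) (h : N.type = D.gtype) :
    Valid (D.relabel (Tp.div N D h) rfl) N := by
  intro K hKsem hK
  have hg : ∀ o, ((fun o : Option D.E => o.elim (K none) fun d => K (some d)) o).gtype =
      (D.relabel (Tp.div N D h) rfl).edgeType o := by
    rintro (_ | d)
    · exact hK none
    · exact hK (some d)
  refine Tp.mem_sem_of_isIso (HGraph.subst_congr _ _ ?_)
    ((Tp.mem_sem_div.1 (hKsem none)).2 (fun d => K (some d)) (fun d => hKsem (some d)) hg)
  rintro (_ | d) <;> exact .refl _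

theorem valid_times (M : TGraph ty) : Valid M (Tp.times M) := by
  intro K hKsem hK
  rw [Tp.sem_times]
  exact mem_biorthogonal_of_isIso ⟨K, hK, hKsem, .refl _⟩ (HGraph.gtype_subst _ _ _) (.refl _)

theorem Valid.div_right {N : Tp ty} {D : Denominator (Tp.type (ty := ty))} {h : N.type = D.gtype}
    {F : TGraph ty} (hF : IsSequent F (Tp.div N D h))
    (hv : Valid ((D.relabel (Tp.div N D h) rfl).replaceEdge none F (hF.gtype_eq rfl)) N) :
    Valid F (Tp.div N D h) := by
  intro K hKsem hK
  refine Tp.mem_sem_div.2 ⟨(HGraph.gtype_subst _ _ _).trans hF, fun K' hKsem' hK' => ?_⟩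
  -- The value `F` at `none` is a dummy: the `$`-edge has been replaced and is not among the
  -- remaining edges.
  let U : ((D.relabel (Tp.div N D h) rfl).replaceEdge none F (hF.gtype_eq rfl)).E → TGraph ty :=
    Sum.elim (fun o => o.1.elim F K') fun f => K f.2
  have hUsem : ∀ e, U e ∈ (HGraph.lab _ e).sem := by
    rintro (⟨_ | d, hd⟩ | f)
    · exact absurd ⟨(), rfl⟩ hd
    · exact hKsem' d
    · exact hKsem f.2
  have hU : ∀ e, (U e).gtype = HGraph.edgeType _ e := fun e =>
    (Tp.isSequent_of_mem_sem (hUsem e)).gtype_eq rfl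
  refine Tp.mem_sem_of_isIso ?_ (hv U hUsem hU)
  refine HGraph.replaceAll_subst _ _ _ _ hU _ (fun _ => .refl _) ?_
  rintro (_ | d) hd
  · exact absurd ⟨(), rfl⟩ hd
  · exact .refl _

/-- The graph put for `e` lies only in a closure. With all other edges filled, `G` is a context with
hole `e` and a closed target, so that graph may be assumed to be a filling of `F`; then the premise
applies by associativity. -/
theorem Valid.times_left {F G : TGraph ty} {A : Tp ty} (hGA : IsSequent G A) {e : G.E}
    (he : G.lab e = Tp.times F)
    (hv : Valid (G.replaceEdge e F (IsSequent.gtype_eq (A := Tp.times F) rfl he)) A) :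
    Valid G A := by
  classical
  intro K hKsem hK
  let ε : {e' // e' ≠ e} ↪ G.E := .subtype _
  have hε : e ∉ Set.range ε := by simp [ε]
  have hr : ∀ e', e' ∉ Set.range ε → e' = e := by simp [ε]
  have hKe : K e ∈ biorthogonal (Tp.times F) _ := Tp.sem_times F ▸ he ▸ hKsem e
  have hiso : ∀ H h1 h2, ((G.replaceAll ε (fun e' => K e') fun e' => hK e').replaceEdge
      (.inl ⟨e, hε⟩) H h1).IsIso (G.subst (Function.update K e H) h2) := fun H h1 h2 =>
    G.replaceAll_replaceEdge ε _ _ e hε hr H h1 h2 (.of_eq (Function.update_self e H K).symm)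
      fun e' => .of_eq (Function.update_of_ne e'.2 _ _).symm
  have hKu : Function.update K e (K e) = K := Function.update_eq_self _ _
  have h2 : ∀ e', (Function.update K e (K e) e').gtype = G.edgeType e' := by
    rw [hKu]
    exact hK
  refine Tp.mem_sem_of_isIso ((hiso (K e) _ h2).trans (HGraph.subst_congr _ _ fun e' =>
    .of_eq (congrFun hKu e'))) (replaceEdge_mem_of_mem_biorthogonal
      (Q := G.replaceAll ε (fun e' => K e') fun e' => hK e') (e := .inl ⟨e, hε⟩)
      (Tp.biorthogonal_sem_subset A) ((HGraph.gtype_replaceAll _ _ _ _).trans hGA) he hKe ?_)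
  rintro H' ⟨J, hJ, hJsem, hi⟩ h'
  let U : (G.replaceEdge e F (IsSequent.gtype_eq (A := Tp.times F) rfl he)).E → TGraph ty :=
    Sum.elim (fun e' => K e'.1) fun f => J f.2
  have hUsem : ∀ e', U e' ∈ (HGraph.lab _ e').sem := by
    rintro (e' | f)
    · exact hKsem e'.1
    · exact hJsem f.2
  have hU : ∀ e', (U e').gtype = HGraph.edgeType _ e' := fun e' =>
    (Tp.isSequent_of_mem_sem (hUsem e')).gtype_eq rfl
  have h3 : ∀ e', (Function.update K e H' e').gtype = G.edgeType e' := by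
    intro e'
    by_cases hee : e' = e
    · subst hee
      rw [Function.update_self]
      exact h'.gtype_eq he
    · rw [Function.update_of_ne hee, hK]
  refine Tp.mem_sem_of_isIso (.trans ?_ (hiso H' _ h3).symm) (hv U hUsem hU)
  refine HGraph.replaceAll_subst _ _ _ _ hU _ (fun _ => ?_) fun e' he' => ?_
  · exact hi.trans (.of_eq (Function.update_self e H' K).symm)
  · exact .of_eq (Function.update_of_ne (fun hc => he' ⟨(), hc.symm⟩) _ _).symm

theorem Derives.valid {c : Prop} {F : TGraph ty} {B : Tp ty} (h : Derives ty c F B) :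
    Valid F B := by
  induction h with
  | iso hG _ ih => exact ih.of_isIso hG
  | ax p => exact valid_handle _
  | div_left N D hND H A e he K hK h hs ih ihs =>
    subst he
    exact (ih.replaceEdge e _ (valid_relabel _ D hND)).replaceAll _ K _ ihs
  | div_right N D hND F hF h ih => exact ih.div_right hF
  | times_left F G A e he h ih =>
    exact ih.times_left ((HGraph.gtype_replaceAll _ _ _ _).symm.trans h.isSequent) he
  | times_right M K hK hs ih => exact (valid_times M).replaceAll _ K _ ih
  | cut hc H G A B hHA e₀ he hH hG ihH ihG =>
    subst he
    exact ihG.replaceEdge e₀ _ ihH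

/-- Evaluate validity at the handles of the labels of `F`: the filling is `F` itself. -/
theorem Valid.derivable {F : TGraph ty} {B : Tp ty} (h : Valid F B) : HLDerivable ty F B :=
  B.handle_mem_sem_and_derivable.2 _ (Tp.mem_sem_of_isIso (F.subst_handle F.gtype_handle_lab)
    (h _ (fun e => (F.lab e).handle_mem_sem_and_derivable.1) _))

end CutElimination

theorem mainTheorem1 {Pr : Type} (ty : Pr → ℕ) :
    (∀ (F : TGraph ty) (B : Tp ty), HLCutDerivable ty F B → HLDerivable ty F B) ∧
    (∀ (H G : TGraph ty) (A B : Tp ty) (hHA : IsSequent H A) (e₀ : G.E) (he : G.lab e₀ = A),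
      HLDerivable ty H A → HLDerivable ty G B →
        HLDerivable ty (G.replaceEdge e₀ H (hHA.gtype_eq he)) B) := by
  refine ⟨fun F B h => h.valid.derivable, fun H G A B hHA e₀ he hH hG => ?_⟩
  subst he
  exact (hG.valid.replaceEdge e₀ _ hH.valid).derivable
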